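/- **Setting.** A quantum channel on $k$ qubits is a linear, completely positive, trace-preserving map $\Phi$ on the operators on $(\mathbb{C}^2)^{\otimes k}$. For a qubit $i\in[k]$ let $|I_i|$ be the least cardinality of a set $S\subseteq[k]$ such that $\mathrm{Tr}_{S}(\Phi(\rho))=\mathrm{Tr}_{S}(\Phi(\sigma))$ for all $k$-qubit states $\rho,\sigma$ with $\mathrm{Tr}_i(\rho)=\mathrm{Tr}_i(\sigma)$. The light-cone size of $\Phi$ is $\max_{i\in[k]}|I_i|$. For $0\le p\le 1$ let $\mathcal{D}_p(X)=(1-p)X+p\,\mathrm{Tr}(X)\,\frac{\mathbb{1}}{2}$ be the single-qubit depolarizing channel, and write $\|X\|_1=\mathrm{Tr}\sqrt{X^\dagger X}$. **Proposition.** Let $0\le p\le 1$ and let $|I|\ge 0$ be an integer. 1. Let $\mathcal{C}_1,\dots,\mathcal{C}_n$ be quantum channels on $k$ qubits, each of light-cone size at most $|I|$, and let $$\mathcal{A}=(\mathcal{D}_p^{\otimes k}\circ\mathcal{C}_n)\circ\cdots\circ(\mathcal{D}_p^{\otimes k}\circ\mathcal{C}_1)$$ be the corresponding noisy circuit with $n$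 layers. Then for any two $k$-qubit states $\rho,\sigma$ $$\|\mathcal{A}(\rho)-\mathcal{A}(\sigma)\|_1\le 2k\,\bigl(2|I|(1-p)\bigr)^n .$$ 2. Consequently, if $2|I|(1-p)<1$, any two outputs become indistinguishable in logarithmic depth: there is a constant $c>0$, depending only on $|I|$ and $p$, such that for all $k$ and $n$, every circuit $\mathcal{A}$ as in part 1, every $\varepsilon>0$ with $n\ge c\log(k/\varepsilon)$ (for $k\ge 1$) and any two $k$-qubit states $\rho,\sigma$, $$\tfrac12\|\mathcal{A}(\rho)-\mathcal{A}(\sigma)\|_1\le\varepsilon .$$ -/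

import Mathlib

open scoped ComplexOrder MatrixOrder Matrix.Norms.L2Operator CStarAlgebra

noncomputable section

namespace NoisyCircuit

/-- Operators on `k` qubits, as matrices in the computational basis `{0,1}^k`. -/
abbrev Op (k : ℕ) : Type := Matrix (Fin k → Fin 2) (Fin k → Fin 2) ℂ

/-- `ρ` is a quantum state (density operator) of `k` qubits. -/
structure IsState {k : ℕ} (ρ : Op k) : Prop where
  posSemidef : ρ.PosSemidef
  trace_eq_one : ρ.trace = 1

/-- The trace norm `‖X‖₁ = Tr √(X† X)`. -/
def traceNorm {k : ℕ} (X : Op k) : ℝ := (CFC.sqrt (X.conjTranspose * X)).trace.re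

/-- A quantum channel on `k` qubits: a linear completely positive trace-preserving map. -/
structure Channel (k : ℕ) extends Op k →CP Op k where
  trace_map : ∀ X : Op k, (toLinearMap X).trace = X.trace

/-- The basis label of `k` qubits that is `c` on the qubits in `S` and `a` on the others. -/
def glue {k : ℕ} (S : Finset (Fin k)) (c : {i // i ∈ S} → Fin 2) (a : {i // i ∉ S} → Fin 2) :
    Fin k → Fin 2 :=
  fun i => if h : i ∈ S then c ⟨i, h⟩ else a ⟨i, h⟩

/-- The partial trace `Tr_S` over the qubits in `S`; the result acts on the other qubits. -/
def partialTrace {k : ℕ} (S : Finset (Fin k)) (X : Op k) :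
    Matrix ({i // i ∉ S} → Fin 2) ({i // i ∉ S} → Fin 2) ℂ :=
  Matrix.of fun a b => ∑ c : {i // i ∈ S} → Fin 2, X (glue S c a) (glue S c b)

/-- `S` contains the influence of the input qubit `i` on the output of `Φ`: input states that agree
after discarding `i` are mapped to output states that agree after discarding `S`. -/
def Shields {k : ℕ} (Φ : Op k →ₗ[ℂ] Op k) (i : Fin k) (S : Finset (Fin k)) : Prop :=
  ∀ ρ σ : Op k, IsState ρ → IsState σ → partialTrace {i} ρ = partialTrace {i} σ →
    partialTrace S (Φ ρ) = partialTrace S (Φ σ)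

/-- The size `|I_i|` of a minimal set `I_i` of output qubits that contains the influence of the
input qubit `i`. (For a channel, the set of all qubits always qualifies.) -/
def lightConeAt {k : ℕ} (Φ : Op k →ₗ[ℂ] Op k) (i : Fin k) : ℕ :=
  sInf {m : ℕ | ∃ S : Finset (Fin k), Shields Φ i S ∧ S.card = m}

/-- The light-cone size `|I| = max_i |I_i|`. -/
def lightCone {k : ℕ} (Φ : Op k →ₗ[ℂ] Op k) : ℕ :=
  Finset.univ.sup (lightConeAt Φ)

/-- The single-qubit depolarizing map `D_p(X) = (1 - p) X + p Tr(X) 𝟙/2`. -/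
def depolarizing (p : ℝ) :
    Matrix (Fin 2) (Fin 2) ℂ →ₗ[ℂ] Matrix (Fin 2) (Fin 2) ℂ :=
  ((1 - p : ℝ) : ℂ) • LinearMap.id +
    ((p / 2 : ℝ) : ℂ) • (Matrix.traceLinearMap (Fin 2) ℂ ℂ).smulRight 1

/-- The tensor power `N^{⊗k}` of a single-qubit map `N`: the linear map that sends the matrix unit
`|c⟩⟨d| = ⨂_i |c_i⟩⟨d_i|` to `⨂_i N(|c_i⟩⟨d_i|)`. -/
def tensorPower (k : ℕ) (N : Matrix (Fin 2) (Fin 2) ℂ →ₗ[ℂ] Matrix (Fin 2) (Fin 2) ℂ) :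
    Op k →ₗ[ℂ] Op k where
  toFun X := Matrix.of fun a b => ∑ c : Fin k → Fin 2, ∑ d : Fin k → Fin 2,
    X c d * ∏ i, N (Matrix.single (c i) (d i) 1) (a i) (b i)
  map_add' X Y := by
    ext a b
    simp [add_mul, Finset.sum_add_distrib]
  map_smul' r X := by
    ext a b
    simp [Finset.mul_sum, mul_assoc]

/-- The noisy circuit `(D_p^{⊗k} ∘ C_n) ∘ ⋯ ∘ (D_p^{⊗k} ∘ C_1)`: each computational layer is
directly followed by local depolarizing noise. -/
def noisyCircuit {k : ℕ} (p : ℝ) : (n : ℕ) → (Fin n → Channel k) → (Op k →ₗ[ℂ] Op k)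
  | 0, _ => LinearMap.id
  | n + 1, C => tensorPower k (depolarizing p) ∘ₗ (C (Fin.last n)).toLinearMap ∘ₗ
      noisyCircuit p n (fun j => C j.castSucc)

end NoisyCircuit

end

/-! The proof tracks a cost finer than the trace norm, `LocalCost`: a Hermitian operator is split
into Hermitian pieces, each killed by tracing out some qubit, and the trace norms of the pieces are
added up. By the triangle inequality the cost bounds the trace norm. Three estimates give the
theorem.

A difference of two states costs at most `2k`: exchange the qubits of `ρ` for those of `σ` one at a
time (`IsState.localCost_sub`).

A channel of light-cone size at most `L` multiplies the cost by at most `2L`: a piece killed by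
tracing out `i` is sent to an operator killed by tracing out at most `L` qubits, which splits again
with a factor 2 per qubit (`LocalCost.map_channel`).

Noise multiplies the cost by `1 - p`: on a piece killed by tracing out `i`, the depolarizing map at
`i` is multiplication by `1 - p`, and the noise on the other qubits is a trace-norm contraction
(`LocalCost.map_depolarizing`). -/

noncomputable section

namespace NoisyCircuit

open Matrix Function

/-! ### Trace norm and positive trace-preserving maps. -/

section TraceNorm

variable {k : ℕ}

lemma re_trace_mul_nonneg {A B : Op k} (hA : A.PosSemidef) (hB : B.PosSemidef) :
    0 ≤ (A * B).trace.re := by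
  obtain ⟨R, rfl⟩ := CStarAlgebra.nonneg_iff_eq_star_mul_self.mp
    (Matrix.nonneg_iff_posSemidef.mpr hA)
  have h := (hB.mul_mul_conjTranspose_same R).trace_nonneg
  rw [Matrix.trace_mul_cycle, ← star_eq_conjTranspose] at h
  exact (Complex.le_def.mp h).1

/-- With `Q` the spectral projection of `A - B` onto the positive axis, the trace of the positive
part is `Tr QA - Tr QB`, and `0 ≤ Q ≤ 1` gives the bound. -/
lemma re_trace_posPart_sub_le {A B : Op k} (hA : A.PosSemidef) (hB : B.PosSemidef) :
    ((A - B)⁺).trace.re ≤ A.trace.re := by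
  have hX : IsSelfAdjoint (A - B) := (hA.isHermitian.sub hB.isHermitian)
  have hc (f : ℝ → ℝ) : ContinuousOn f (spectrum ℝ (A - B)) :=
    (Matrix.finite_real_spectrum (A := A - B)).continuousOn f
  set Q : Op k := cfc (fun t : ℝ => if 0 < t then (1 : ℝ) else 0) (A - B) with hQ
  have hQ0 : Q.PosSemidef := Matrix.nonneg_iff_posSemidef.mp <|
    cfc_nonneg fun t _ => by split_ifs <;> norm_num
  have hQ1 : (1 - Q).PosSemidef := Matrix.le_iff.mp <|
    cfc_le_one _ _ fun t _ => by split_ifs <;> norm_num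
  have hQX : Q * (A - B) = (A - B)⁺ := by
    rw [CFC.posPart_def, cfcₙ_eq_cfc]
    conv_lhs => rw [hQ]; enter [2]; rw [← cfc_id' ℝ (A - B)]
    rw [← cfc_mul _ _ _ (hc _) (hc _)]
    refine cfc_congr fun t _ => ?_
    by_cases ht : 0 < t
    · simp [ht, posPart_eq_self.mpr ht.le]
    · simp [ht, posPart_eq_zero.mpr (not_lt.mp ht)]
  have h1 := re_trace_mul_nonneg hQ0 hB
  have h2 := re_trace_mul_nonneg hQ1 hA
  rw [← hQX]
  simp only [mul_sub, sub_mul, one_mul, Matrix.trace_sub, Complex.sub_re] at h2 ⊢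
  linarith

lemma traceNorm_eq {X : Op k} (hX : X.IsHermitian) :
    traceNorm X = (X⁺).trace.re + (X⁻).trace.re := by
  have h : CFC.sqrt (X.conjTranspose * X) = X⁺ + X⁻ :=
    (CFC.posPart_add_negPart X hX).symm
  rw [traceNorm, h, Matrix.trace_add, Complex.add_re]

/-- The Jordan decomposition attains equality here, so the trace norm is a minimum over positive
decompositions; the triangle inequality and contractivity under positive maps follow. -/
lemma traceNorm_sub_le {A B : Op k} (hA : A.PosSemidef) (hB : B.PosSemidef) :
    traceNorm (A - B) ≤ A.trace.re + B.trace.re := by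
  rw [traceNorm_eq (hA.isHermitian.sub hB.isHermitian)]
  have h := re_trace_posPart_sub_le hB hA
  rw [← neg_sub, CFC.posPart_neg] at h
  exact add_le_add (re_trace_posPart_sub_le hA hB) h

lemma exists_posSemidef_sub {X : Op k} (hX : X.IsHermitian) :
    ∃ A B : Op k, A.PosSemidef ∧ B.PosSemidef ∧ X = A - B ∧
      traceNorm X = A.trace.re + B.trace.re :=
  ⟨X⁺, X⁻, Matrix.nonneg_iff_posSemidef.mp (CFC.posPart_nonneg X),
    Matrix.nonneg_iff_posSemidef.mp (CFC.negPart_nonneg X),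
    (CFC.posPart_sub_negPart X hX).symm, traceNorm_eq hX⟩

lemma traceNorm_add_le {X Y : Op k} (hX : X.IsHermitian) (hY : Y.IsHermitian) :
    traceNorm (X + Y) ≤ traceNorm X + traceNorm Y := by
  obtain ⟨A, B, hA, hB, rfl, h⟩ := exists_posSemidef_sub hX
  obtain ⟨A', B', hA', hB', rfl, h'⟩ := exists_posSemidef_sub hY
  have := traceNorm_sub_le (hA.add hA') (hB.add hB')
  rw [add_sub_add_comm] at this
  simp only [Matrix.trace_add, Complex.add_re] at this
  linarith

lemma traceNorm_neg (X : Op k) : traceNorm (-X) = traceNorm X := by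
  simp [traceNorm]

lemma traceNorm_sub_le_add {X Y : Op k} (hX : X.IsHermitian) (hY : Y.IsHermitian) :
    traceNorm (X - Y) ≤ traceNorm X + traceNorm Y := by
  rw [sub_eq_add_neg, ← traceNorm_neg Y]
  exact traceNorm_add_le hX hY.neg

lemma traceNorm_nonneg {X : Op k} (hX : X.IsHermitian) : 0 ≤ traceNorm X := by
  obtain ⟨A, B, hA, hB, -, h⟩ := exists_posSemidef_sub hX
  rw [h]
  exact add_nonneg (Complex.le_def.mp hA.trace_nonneg).1 (Complex.le_def.mp hB.trace_nonneg).1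

@[simp]
lemma traceNorm_zero : traceNorm (0 : Op k) = 0 := by
  simp [traceNorm]

lemma traceNorm_smul {r : ℝ} (hr : 0 ≤ r) (X : Op k) :
    traceNorm ((r : ℂ) • X) = r * traceNorm X := by
  change (CFC.abs ((r : ℂ) • X)).trace.re = r * (CFC.abs X).trace.re
  rw [CFC.abs_smul, Matrix.trace_smul]
  simp [abs_of_nonneg hr]

/-- A linear map that is positive and trace-preserving. -/
structure IsPTP (Φ : Op k →ₗ[ℂ] Op k) : Prop where
  posSemidef : ∀ X : Op k, X.PosSemidef → (Φ X).PosSemidef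
  trace_map : ∀ X : Op k, (Φ X).trace = X.trace

namespace IsPTP

variable {Φ Ψ : Op k →ₗ[ℂ] Op k}

lemma isHermitian (h : IsPTP Φ) {X : Op k} (hX : X.IsHermitian) : (Φ X).IsHermitian := by
  obtain ⟨A, B, hA, hB, rfl, -⟩ := exists_posSemidef_sub hX
  rw [map_sub]
  exact (h.posSemidef A hA).isHermitian.sub (h.posSemidef B hB).isHermitian

lemma traceNorm_le (h : IsPTP Φ) {X : Op k} (hX : X.IsHermitian) :
    traceNorm (Φ X) ≤ traceNorm X := by
  obtain ⟨A, B, hA, hB, rfl, hn⟩ := exists_posSemidef_sub hX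
  rw [map_sub, hn, ← h.trace_map A, ← h.trace_map B]
  exact traceNorm_sub_le (h.posSemidef A hA) (h.posSemidef B hB)

lemma id : IsPTP (LinearMap.id : Op k →ₗ[ℂ] Op k) := ⟨fun _ h => h, fun _ => rfl⟩

lemma comp (hΦ : IsPTP Φ) (hΨ : IsPTP Ψ) : IsPTP (Φ ∘ₗ Ψ) :=
  ⟨fun X hX => hΦ.posSemidef _ (hΨ.posSemidef X hX),
    fun X => (hΦ.trace_map _).trans (hΨ.trace_map X)⟩

lemma convex (hΦ : IsPTP Φ) (hΨ : IsPTP Ψ) {r : ℝ} (h0 : 0 ≤ r) (h1 : r ≤ 1) :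
    IsPTP (((1 - r : ℝ) : ℂ) • Φ + (r : ℂ) • Ψ) where
  posSemidef X hX := by
    have h0' : (0 : ℂ) ≤ (r : ℂ) := by exact_mod_cast h0
    have h1' : (0 : ℂ) ≤ ((1 - r : ℝ) : ℂ) := by exact_mod_cast sub_nonneg.mpr h1
    exact ((hΦ.posSemidef X hX).smul h1').add ((hΨ.posSemidef X hX).smul h0')
  trace_map X := by
    simp only [LinearMap.add_apply, LinearMap.smul_apply, Matrix.trace_add, Matrix.trace_smul,
      hΦ.trace_map, hΨ.trace_map]
    rw [← add_smul]
    simp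

end IsPTP

lemma Channel.isPTP (C : Channel k) : IsPTP C.toLinearMap where
  posSemidef _ hX := Matrix.nonneg_iff_posSemidef.mp <|
    map_nonneg C.toCompletelyPositiveMap (Matrix.nonneg_iff_posSemidef.mpr hX)
  trace_map := C.trace_map

end TraceNorm

/-! ### Partial traces written on labels of all qubits. -/

section PartialTrace

variable {k : ℕ}

lemma sum_sum_update (i : Fin k) (F : (Fin k → Fin 2) → ℂ) :
    ∑ c, ∑ e, F (update c i e) = 2 * ∑ c, F c := by
  have h : ∑ x : (Fin k → Fin 2) × Fin 2, F (update x.1 i x.2) =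
      ∑ x : (Fin k → Fin 2) × Fin 2, F x.1 := by
    -- Swapping `e` with the `i`-th entry of `c` is an involution on pairs `(c, e)`.
    refine Finset.sum_bij' (fun x _ => (update x.1 i x.2, x.1 i))
      (fun x _ => (update x.1 i x.2, x.1 i)) ?_ ?_ ?_ ?_ ?_ <;> simp
  rw [Fintype.sum_prod_type, Fintype.sum_prod_type] at h
  simpa [Finset.mul_sum] using h

/-- The function `(a, b) ↦ ∑ c, X (c on S, a off S) (c on S, b off S)`, a multiple of the
partial trace on labels of all qubits. -/
def spreadTrace (S : Finset (Fin k)) (X : Op k) (a b : Fin k → Fin 2) : ℂ :=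
  ∑ c : Fin k → Fin 2, X (S.piecewise c a) (S.piecewise c b)

lemma spreadTrace_eq (S : Finset (Fin k)) (X : Op k) (a b : Fin k → Fin 2) :
    spreadTrace S X a b = Fintype.card ({i // i ∉ S} → Fin 2) *
      partialTrace S X (fun i => a i) (fun i => b i) := by
  have hg (c a : Fin k → Fin 2) :
      S.piecewise c a = glue S (fun i => c i) (fun i => a i) := by
    ext i
    by_cases hi : i ∈ S <;> simp [glue, hi]
  have hsum : spreadTrace S X a b = ∑ c : Fin k → Fin 2,
      X (glue S (fun i => c i) fun i => a i) (glue S (fun i => c i) fun i => b i) :=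
    Finset.sum_congr rfl fun c _ => by rw [hg, hg]
  refine hsum.trans ?_
  refine (Fintype.sum_equiv (Equiv.piEquivPiSubtypeProd (fun i => i ∈ S) (fun _ : Fin k => Fin 2)) _
    (fun x => X (glue S x.1 fun i => a i) (glue S x.1 fun i => b i)) (fun c => rfl)).trans ?_
  rw [Fintype.sum_prod_type_right]
  simp [partialTrace]

lemma partialTrace_eq_zero_iff (S : Finset (Fin k)) (X : Op k) :
    partialTrace S X = 0 ↔ ∀ a b, spreadTrace S X a b = 0 := by
  refine ⟨fun h a b => by simp [spreadTrace_eq, h], fun h => ?_⟩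
  ext a b
  have := h (glue S 0 a) (glue S 0 b)
  rw [spreadTrace_eq, mul_eq_zero_iff_left (by simp)] at this
  have hr (a : {i // i ∉ S} → Fin 2) : (fun i : {i // i ∉ S} => glue S 0 a i) = a := by
    ext i
    simp [glue, i.2]
  simpa [hr] using this

lemma partialTrace_sub (S : Finset (Fin k)) (X Y : Op k) :
    partialTrace S (X - Y) = partialTrace S X - partialTrace S Y := by
  ext a b
  simp [partialTrace]

lemma partialTrace_smul (S : Finset (Fin k)) (r : ℂ) (X : Op k) :
    partialTrace S (r • X) = r • partialTrace S X := by
  ext a b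
  simp [partialTrace, Finset.mul_sum]

lemma partialTrace_empty_eq_zero_iff (X : Op k) : partialTrace ∅ X = 0 ↔ X = 0 := by
  rw [partialTrace_eq_zero_iff]
  simp only [spreadTrace, Finset.piecewise_empty]
  simp [← Matrix.ext_iff]

lemma spreadTrace_univ (X : Op k) (a b : Fin k → Fin 2) :
    spreadTrace Finset.univ X a b = X.trace := by
  simp [spreadTrace, Matrix.trace]

end PartialTrace

/-! ### Replacing one qubit by the maximally mixed state. -/

section SiteMix

variable {k : ℕ}

/-- The map that replaces qubit `i` by a maximally mixed qubit. -/
def siteMix (i : Fin k) : Op k →ₗ[ℂ] Op k where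
  toFun X := Matrix.of fun a b =>
    if a i = b i then 2⁻¹ * ∑ e, X (update a i e) (update b i e) else 0
  map_add' X Y := by
    ext a b
    by_cases h : a i = b i <;> simp [h]
    ring
  map_smul' r X := by
    ext a b
    by_cases h : a i = b i <;> simp [h]
    ring

lemma siteMix_apply (i : Fin k) (X : Op k) (a b : Fin k → Fin 2) :
    siteMix i X a b =
      if a i = b i then 2⁻¹ * ∑ e, X (update a i e) (update b i e) else 0 := rfl

lemma siteMix_isPTP (i : Fin k) : IsPTP (siteMix i) where
  posSemidef X hX := by
    have h0 : (0 : ℂ) ≤ 2⁻¹ := by positivity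
    -- Schur product theorem: the map is an entrywise product of the positive kernel `[a i = b i]`
    -- with a positive sum of submatrices of `X`.
    have h := (((PosSemidef.one (n := Fin 2) (R := ℂ)).submatrix
      (fun a : Fin k → Fin 2 => a i))).hadamard
      ((Matrix.posSemidef_sum Finset.univ fun e _ =>
        hX.submatrix (fun a : Fin k → Fin 2 => update a i e)).smul h0)
    refine (congrArg PosSemidef ?_).mp h
    ext a b
    by_cases hab : a i = b i <;> simp [siteMix_apply, Matrix.one_apply, hab, mul_add]
  trace_map X := by
    have h := sum_sum_update i fun c => X c c
    simp only [Matrix.trace, Matrix.diag, siteMix_apply, if_true, ← Finset.mul_sum, h]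
    ring

lemma siteMix_comm (i j : Fin k) (X : Op k) :
    siteMix i (siteMix j X) = siteMix j (siteMix i X) := by
  rcases eq_or_ne i j with rfl | hij
  · rfl
  ext a b
  by_cases hi : a i = b i <;> by_cases hj : a j = b j <;>
    simp [siteMix_apply, hi, hj, hij, hij.symm, -Fin.sum_univ_two]
  rw [← Finset.mul_sum, ← Finset.mul_sum, Finset.sum_comm]
  simp only [update_comm hij]

/-- Once qubit `i` is maximally mixed and in product with the rest, the marginal off `S` is
determined by the marginal off `insert i S`. -/
lemma partialTrace_siteMix_eq_zero {i : Fin k} {S : Finset (Fin k)} (hi : i ∉ S) {X : Op k}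
    (h : partialTrace (insert i S) X = 0) : partialTrace S (siteMix i X) = 0 := by
  rw [partialTrace_eq_zero_iff] at h ⊢
  intro a b
  have hu (c a : Fin k → Fin 2) (e : Fin 2) :
      update (S.piecewise c a) i e = (insert i S).piecewise (update c i e) a := by
    ext j
    rcases eq_or_ne j i with rfl | hj
    · simp
    · by_cases hS : j ∈ S <;> simp [hj, hS]
  have hs := sum_sum_update i
    fun c => X ((insert i S).piecewise c a) ((insert i S).piecewise c b)
  simp only [spreadTrace] at h ⊢
  rw [h, mul_zero] at hs
  simp only [siteMix_apply, Finset.piecewise_eq_of_notMem _ _ _ hi, hu]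
  split_ifs
  · rw [← Finset.mul_sum, hs, mul_zero]
  · simp

lemma siteMix_eq_zero_iff (i : Fin k) (X : Op k) :
    siteMix i X = 0 ↔ partialTrace {i} X = 0 := by
  constructor
  · intro h
    rw [partialTrace_eq_zero_iff]
    intro a b
    have hab (e : Fin 2) := congrFun (congrFun h (update a i e)) (update b i e)
    simp only [siteMix_apply, update_self, if_true, update_idem] at hab
    have h2 := sum_sum_update i fun c => X (update a i (c i)) (update b i (c i))
    simp only [update_self] at h2
    have h3 : ∑ e, X (update a i e) (update b i e) = 0 := by simpa using hab 0
    rw [h3] at h2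
    simpa [spreadTrace, Finset.piecewise_singleton] using h2.symm
  · intro h
    rw [← partialTrace_empty_eq_zero_iff]
    refine partialTrace_siteMix_eq_zero (Finset.notMem_empty i) ?_
    rw [partialTrace_eq_zero_iff] at h ⊢
    simpa using h

end SiteMix

/-! ### Depolarizing noise, one site at a time. -/

section Depolarizing

variable {k : ℕ}

lemma depolarizing_single_apply (r : ℝ) (x y u v : Fin 2) :
    depolarizing r (Matrix.single x y 1) u v =
      (1 - r) * (if x = u ∧ y = v then 1 else 0) +
        r * (2⁻¹ * ((if x = y then 1 else 0) * (if u = v then 1 else 0))) := by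
  by_cases h : x = y
  · subst h
    simp [depolarizing, Matrix.single_apply, Matrix.one_apply]
    ring_nf
  · simp [depolarizing, Matrix.single_apply, h,
      Matrix.trace_single_eq_of_ne x y (1 : ℂ) h]

/-- The tensor product `⨂_i D_{q i}` of depolarizing maps of site-dependent strength. -/
def depolarizingProduct (q : Fin k → ℝ) : Op k →ₗ[ℂ] Op k where
  toFun X := Matrix.of fun a b => ∑ c : Fin k → Fin 2, ∑ d : Fin k → Fin 2,
    X c d * ∏ i, depolarizing (q i) (Matrix.single (c i) (d i) 1) (a i) (b i)
  map_add' X Y := by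
    ext a b
    simp [add_mul, Finset.sum_add_distrib]
  map_smul' r X := by
    ext a b
    simp [Finset.mul_sum, mul_assoc]

lemma depolarizingProduct_apply (q : Fin k → ℝ) (X : Op k) (a b : Fin k → Fin 2) :
    depolarizingProduct q X a b = ∑ c : Fin k → Fin 2, ∑ d : Fin k → Fin 2,
      X c d * ∏ i, depolarizing (q i) (Matrix.single (c i) (d i) 1) (a i) (b i) := rfl

lemma depolarizingProduct_const (p : ℝ) :
    depolarizingProduct (fun _ : Fin k => p) = tensorPower k (depolarizing p) := rfl

lemma depolarizingProduct_zero : depolarizingProduct (0 : Fin k → ℝ) = LinearMap.id := by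
  ext X a b
  have h (a b c d : Fin k → Fin 2) :
      (∏ i, depolarizing 0 (Matrix.single (c i) (d i) 1) (a i) (b i)) =
        if c = a ∧ d = b then 1 else 0 := by
    simp only [depolarizing_single_apply]
    simp [Finset.prod_ite_zero, funext_iff, forall_and]
  simp [depolarizingProduct_apply, h, ite_and]

/-- Site-dependent strengths allow the noise to be switched on qubit by qubit: at `i` it is the
mixture of the identity and `siteMix i` with weights `1 - r` and `r`. -/
lemma depolarizingProduct_update (q : Fin k → ℝ) {i : Fin k} (hi : q i = 0) (r : ℝ) :
    depolarizingProduct (update q i r) =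
      (((1 - r : ℝ) : ℂ) • LinearMap.id + (r : ℂ) • siteMix i) ∘ₗ depolarizingProduct q := by
  refine LinearMap.ext fun X => ?_
  ext a b
  let R (a b c d : Fin k → Fin 2) : ℂ := ∏ j ∈ Finset.univ.erase i,
    depolarizing (q j) (Matrix.single (c j) (d j) 1) (a j) (b j)
  have hR (a b c d : Fin k → Fin 2) (e : Fin 2) : R (update a i e) (update b i e) c d = R a b c d :=
    Finset.prod_congr rfl fun j hj => by simp [Finset.ne_of_mem_erase hj]
  have h0 (a b c d : Fin k → Fin 2) :
      (∏ j, depolarizing (q j) (Matrix.single (c j) (d j) 1) (a j) (b j)) =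
        (if c i = a i ∧ d i = b i then 1 else 0) * R a b c d := by
    rw [← Finset.mul_prod_erase _ _ (Finset.mem_univ i), hi, depolarizing_single_apply]
    simp [R]
  have h1 (c d : Fin k → Fin 2) :
      (∏ j, depolarizing (update q i r j) (Matrix.single (c j) (d j) 1) (a j) (b j)) =
        ((1 - r) * (if c i = a i ∧ d i = b i then 1 else 0) +
        r * (2⁻¹ * ((if c i = d i then 1 else 0) * (if a i = b i then 1 else 0)))) *
          R a b c d := by
    rw [← Finset.mul_prod_erase _ _ (Finset.mem_univ i), update_self, depolarizing_single_apply]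
    congr 1
    exact Finset.prod_congr rfl fun j hj => by simp [Finset.ne_of_mem_erase hj]
  have h2 (x y : Fin 2) : (∑ e : Fin 2, if x = e ∧ y = e then (1 : ℂ) else 0) =
      if x = y then 1 else 0 := by
    rw [Finset.sum_congr rfl fun e _ => by rw [ite_and], Finset.sum_ite_eq]
    simp [eq_comm]
  have h3 : ∑ e, depolarizingProduct q X (update a i e) (update b i e) =
      ∑ c, ∑ d, X c d * ((if c i = d i then 1 else 0) * R a b c d) := by
    simp only [depolarizingProduct_apply, h0, hR, update_self]
    rw [Finset.sum_comm]
    refine Finset.sum_congr rfl fun c _ => ?_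
    rw [Finset.sum_comm]
    refine Finset.sum_congr rfl fun d _ => ?_
    rw [← Finset.mul_sum, ← Finset.sum_mul, h2]
  simp only [LinearMap.comp_apply, LinearMap.add_apply, LinearMap.smul_apply, LinearMap.id_apply,
    Matrix.add_apply, Matrix.smul_apply, siteMix_apply, h3, smul_eq_mul]
  simp only [depolarizingProduct_apply, h0, h1]
  by_cases hab : a i = b i
  · simp only [hab, if_true, Finset.mul_sum, ← Finset.sum_add_distrib]
    refine Finset.sum_congr rfl fun c _ => Finset.sum_congr rfl fun d _ => ?_
    push_cast
    ring
  · simp only [hab, if_false, mul_zero, add_zero, Finset.mul_sum]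
    refine Finset.sum_congr rfl fun c _ => Finset.sum_congr rfl fun d _ => ?_
    push_cast
    ring

lemma depolarizingProduct_piecewise {p : ℝ} (hp0 : 0 ≤ p) (hp1 : p ≤ 1) (S : Finset (Fin k)) :
    IsPTP (depolarizingProduct (S.piecewise (fun _ => p) 0)) ∧
      ∀ i X, siteMix i (depolarizingProduct (S.piecewise (fun _ => p) 0) X) =
        depolarizingProduct (S.piecewise (fun _ => p) 0) (siteMix i X) := by
  induction S using Finset.induction_on with
  | empty =>
    simp only [Finset.piecewise_empty, depolarizingProduct_zero]
    exact ⟨IsPTP.id, fun _ _ => rfl⟩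
  | insert j S hj ih =>
    rw [Finset.piecewise_insert, depolarizingProduct_update _ (by simp [hj])]
    refine ⟨(IsPTP.id.convex (siteMix_isPTP j) hp0 hp1).comp ih.1, fun i X => ?_⟩
    simp [← ih.2, siteMix_comm i j]

/-- `Φ` is the noise on all qubits but `i`. It commutes with `siteMix i`, so the mixed term of the
noise at `i` vanishes and only the factor `1 - p` remains. -/
lemma exists_depolarizing_eq_smul {p : ℝ} (hp0 : 0 ≤ p) (hp1 : p ≤ 1) (i : Fin k) :
    ∃ Φ : Op k →ₗ[ℂ] Op k, IsPTP Φ ∧ ∀ X, siteMix i X = 0 → siteMix i (Φ X) = 0 ∧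
      tensorPower k (depolarizing p) X = ((1 - p : ℝ) : ℂ) • Φ X := by
  obtain ⟨h1, h2⟩ := depolarizingProduct_piecewise (k := k) hp0 hp1 (Finset.univ.erase i)
  refine ⟨_, h1, fun X hX => ?_⟩
  have h3 : siteMix i (depolarizingProduct
      ((Finset.univ.erase i).piecewise (fun _ => p) 0) X) = 0 := by rw [h2, hX, map_zero]
  refine ⟨h3, ?_⟩
  have hu : (fun _ : Fin k => p) =
      update ((Finset.univ.erase i).piecewise (fun _ => p) 0) i p := by
    rw [← Finset.piecewise_insert, Finset.insert_erase (Finset.mem_univ i), Finset.piecewise_univ]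
  have hD := (congrArg depolarizingProduct hu).trans
    (depolarizingProduct_update ((Finset.univ.erase i).piecewise (fun _ => p) 0) (by simp) p)
  rw [← depolarizingProduct_const, hD]
  simp only [LinearMap.comp_apply, LinearMap.add_apply, LinearMap.smul_apply, LinearMap.id_apply,
    h3, smul_zero, add_zero]

end Depolarizing

/-! ### The local cost and its growth under noise and channels. -/

section LocalCost

variable {k : ℕ}

/-- `LocalCost X w`: the Hermitian operator `X` is a sum of Hermitian operators, each of which
vanishes when some single qubit is discarded, with trace norms summing to at most `w`. The least
such `w` is twice the quantum Wasserstein norm of order one. -/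
inductive LocalCost : Op k → ℝ → Prop
  | zero : LocalCost 0 0
  | single (i : Fin k) (X : Op k) : X.IsHermitian → siteMix i X = 0 → LocalCost X (traceNorm X)
  | add (X Y : Op k) (v w : ℝ) : LocalCost X v → LocalCost Y w → LocalCost (X + Y) (v + w)
  | mono (X : Op k) (v w : ℝ) : v ≤ w → LocalCost X v → LocalCost X w

namespace LocalCost

lemma isHermitian {X : Op k} {w : ℝ} (h : LocalCost X w) : X.IsHermitian := by
  induction h with
  | zero => exact Matrix.isHermitian_zero
  | single i X hX _ => exact hX
  | add X Y v w _ _ hX hY => exact hX.add hY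
  | mono X v w _ _ hX => exact hX

lemma traceNorm_le {X : Op k} {w : ℝ} (h : LocalCost X w) : traceNorm X ≤ w := by
  induction h with
  | zero => simp
  | single i X hX _ => exact le_rfl
  | add X Y v w hX hY ihX ihY =>
    exact (traceNorm_add_le hX.isHermitian hY.isHermitian).trans (add_le_add ihX ihY)
  | mono X v w hvw _ ih => exact ih.trans hvw

lemma map {Φ : Op k →ₗ[ℂ] Op k} {r : ℝ} (hr : 0 ≤ r)
    (h : ∀ i X, X.IsHermitian → siteMix i X = 0 → LocalCost (Φ X) (r * traceNorm X))
    {X : Op k} {w : ℝ} (hX : LocalCost X w) : LocalCost (Φ X) (r * w) := by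
  induction hX with
  | zero => simpa using zero
  | single i X hX hi => exact h i X hX hi
  | add X Y v w _ _ ihX ihY => simpa [mul_add] using ihX.add _ _ _ _ ihY
  | mono X v w hvw _ ih => exact ih.mono _ _ _ (mul_le_mul_of_nonneg_left hvw hr)

lemma map_depolarizing {p : ℝ} (hp0 : 0 ≤ p) (hp1 : p ≤ 1) {X : Op k} {w : ℝ}
    (hX : LocalCost X w) : LocalCost (tensorPower k (depolarizing p) X) ((1 - p) * w) := by
  refine hX.map (sub_nonneg.mpr hp1) fun i X hX hi => ?_
  obtain ⟨Φ, hΦ, h⟩ := exists_depolarizing_eq_smul hp0 hp1 i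
  obtain ⟨h1, h2⟩ := h X hi
  rw [h2]
  refine (single i _ ?_ (by rw [map_smul, h1, smul_zero])).mono _ _ _ ?_
  · exact (hΦ.isHermitian hX).smul (by simp [IsSelfAdjoint])
  · rw [traceNorm_smul (sub_nonneg.mpr hp1)]
    exact mul_le_mul_of_nonneg_left (hΦ.traceNorm_le hX) (sub_nonneg.mpr hp1)

/-- Split `X = (X - M X) + M X` with `M = siteMix i`: the first term is killed by `M` and has norm
at most `2‖X‖`, the second is killed by tracing out one qubit fewer and has norm at most `‖X‖`. -/
lemma of_partialTrace_eq_zero (S : Finset (Fin k)) : ∀ X : Op k, X.IsHermitian →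
    partialTrace S X = 0 → LocalCost X (2 * S.card * traceNorm X) := by
  induction S using Finset.induction_on with
  | empty =>
    intro X _ h
    rw [(partialTrace_empty_eq_zero_iff X).mp h]
    simpa using zero
  | insert i S hi ih =>
    intro X hX h
    have hM := siteMix_isPTP i
    have hidem : siteMix i (siteMix i X) = siteMix i X := by
      ext a b
      by_cases hab : a i = b i
      · simp [siteMix_apply, hab]
      · simp [siteMix_apply, hab]
    have h1 := single i (X - siteMix i X) (hX.sub (hM.isHermitian hX))
      (by rw [map_sub, hidem, sub_self])
    have h2 := ih (siteMix i X) (hM.isHermitian hX) (partialTrace_siteMix_eq_zero hi h)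
    have h3 := h1.add _ _ _ _ h2
    rw [sub_add_cancel] at h3
    refine h3.mono _ _ _ ?_
    have h4 := hM.traceNorm_le hX
    have h5 := traceNorm_sub_le_add hX (hM.isHermitian hX)
    have h6 := mul_le_mul_of_nonneg_left h4 (by positivity : (0 : ℝ) ≤ 2 * S.card)
    rw [Finset.card_insert_of_notMem hi]
    push_cast
    linarith

end LocalCost

/-- The Jordan parts have equal trace, so both can be normalised by it. This carries `Shields`,
stated for states, over to Hermitian operators. -/
lemma exists_states_of_trace_eq_zero {X : Op k} (hX : X.IsHermitian) (h0 : X.trace = 0) :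
    X = 0 ∨ ∃ (t : ℂ) (ρ σ : Op k), IsState ρ ∧ IsState σ ∧ t ≠ 0 ∧ X = t • (ρ - σ) := by
  obtain ⟨A, B, hA, hB, rfl, -⟩ := exists_posSemidef_sub hX
  rw [Matrix.trace_sub, sub_eq_zero] at h0
  by_cases ht : A.trace = 0
  · left
    rw [hA.trace_eq_zero_iff.mp ht, hB.trace_eq_zero_iff.mp (h0 ▸ ht), sub_zero]
  · right
    have hpos : 0 ≤ A.trace⁻¹ := by
      obtain ⟨r, hr, h⟩ := RCLike.nonneg_iff_exists_ofReal.mp hA.trace_nonneg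
      rw [← h, ← RCLike.ofReal_inv]
      exact RCLike.ofReal_nonneg.mpr (inv_nonneg.mpr hr)
    refine ⟨A.trace, A.trace⁻¹ • A, A.trace⁻¹ • B, ⟨hA.smul hpos, ?_⟩, ⟨hB.smul hpos, ?_⟩, ht, ?_⟩
    · simp [Matrix.trace_smul, ht]
    · simp [Matrix.trace_smul, ← h0, ht]
    · rw [← smul_sub, smul_inv_smul₀ ht]

lemma Shields.partialTrace_eq_zero {Φ : Op k →ₗ[ℂ] Op k} {i : Fin k} {S : Finset (Fin k)}
    (h : Shields Φ i S) {X : Op k} (hX : X.IsHermitian) (hi : siteMix i X = 0) :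
    partialTrace S (Φ X) = 0 := by
  have h0 : X.trace = 0 := by rw [← (siteMix_isPTP i).trace_map X, hi, Matrix.trace_zero]
  rcases exists_states_of_trace_eq_zero hX h0 with rfl | ⟨t, ρ, σ, hρ, hσ, ht, rfl⟩
  · ext a b
    simp [partialTrace]
  · rw [siteMix_eq_zero_iff, partialTrace_smul, smul_eq_zero_iff_right ht, partialTrace_sub,
      sub_eq_zero] at hi
    rw [map_smul, map_sub, partialTrace_smul, partialTrace_sub, h ρ σ hρ hσ hi, sub_self,
      smul_zero]

lemma Channel.exists_shields (C : Channel k) (i : Fin k) :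
    ∃ S, Shields C.toLinearMap i S ∧ S.card = lightConeAt C.toLinearMap i := by
  -- The infimum is attained because the set of all qubits qualifies, by trace preservation; for an
  -- empty set `sInf` would be a spurious `0`.
  refine Nat.sInf_mem (s := {m : ℕ | ∃ S, Shields C.toLinearMap i S ∧ S.card = m})
    ⟨_, Finset.univ, fun ρ σ hρ hσ _ => ?_, rfl⟩
  rw [← sub_eq_zero, ← partialTrace_sub, partialTrace_eq_zero_iff, ← map_sub]
  intro a b
  rw [spreadTrace_univ, C.isPTP.trace_map, Matrix.trace_sub, hρ.trace_eq_one, hσ.trace_eq_one,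
    sub_self]

lemma LocalCost.map_channel (C : Channel k) {L : ℕ} (hL : lightCone C.toLinearMap ≤ L)
    {X : Op k} {w : ℝ} (hX : LocalCost X w) : LocalCost (C.toLinearMap X) (2 * L * w) := by
  refine hX.map (by positivity) fun i X hX hi => ?_
  obtain ⟨S, hS, hcard⟩ := C.exists_shields i
  have hSL : (S.card : ℝ) ≤ L := by
    exact_mod_cast hcard.trans_le
      ((Finset.le_sup (f := lightConeAt C.toLinearMap) (Finset.mem_univ i)).trans hL)
  refine (of_partialTrace_eq_zero S _ (C.isPTP.isHermitian hX)
    (hS.partialTrace_eq_zero hX hi)).mono _ _ _ ?_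
  have := C.isPTP.traceNorm_le hX
  have := traceNorm_nonneg (C.isPTP.isHermitian hX)
  gcongr

end LocalCost

/-! ### Interpolating between two states qubit by qubit. -/

section Hybrid

variable {k : ℕ}

lemma spreadTrace_update_of_mem {S : Finset (Fin k)} {i : Fin k} (hi : i ∈ S) (X : Op k)
    (a b : Fin k → Fin 2) (e : Fin 2) :
    spreadTrace S X (update a i e) (update b i e) = spreadTrace S X a b := by
  have h (c a : Fin k → Fin 2) : S.piecewise c (update a i e) = S.piecewise c a :=
    Finset.piecewise_congr S (fun _ _ => rfl) fun j hj => by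
      simp [(ne_of_mem_of_not_mem hi hj).symm]
  simp only [spreadTrace, h]

lemma sum_spreadTrace_update_of_notMem {S : Finset (Fin k)} {i : Fin k} (hi : i ∉ S) (X : Op k)
    (a b : Fin k → Fin 2) :
    ∑ e, spreadTrace S X (update a i e) (update b i e) = 2 * spreadTrace (insert i S) X a b := by
  have h (c a : Fin k → Fin 2) (e : Fin 2) :
      S.piecewise c (update a i e) = (insert i S).piecewise (update c i e) a := by
    ext j
    rcases eq_or_ne j i with rfl | hj
    · simp [hi]
    · by_cases hS : j ∈ S <;> simp [hj, hS]
  simp only [spreadTrace, h]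
  rw [Finset.sum_comm]
  exact sum_sum_update i fun c => X ((insert i S).piecewise c a) ((insert i S).piecewise c b)

/-- The product of the reduced state of `σ` on the qubits in `S` and the reduced state of `ρ` on
the other qubits. -/
def hybrid (S : Finset (Fin k)) (ρ σ : Op k) : Op k :=
  Matrix.of fun a b =>
    -- The two factors overcount by `2 ^ (k - |S|)` and `2 ^ |S|`.
    (2 ^ k : ℂ)⁻¹ * (spreadTrace S ρ a b * spreadTrace Sᶜ σ a b)

lemma spreadTrace_posSemidef (S : Finset (Fin k)) {X : Op k} (hX : X.PosSemidef) :
    (Matrix.of (spreadTrace S X)).PosSemidef := by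
  have h := Matrix.posSemidef_sum Finset.univ fun (c : Fin k → Fin 2) _ =>
    hX.submatrix (fun a : Fin k → Fin 2 => S.piecewise c a)
  refine (congrArg PosSemidef ?_).mp h
  ext a b
  simp [spreadTrace, Matrix.sum_apply]

lemma hybrid_posSemidef (S : Finset (Fin k)) {ρ σ : Op k} (hρ : ρ.PosSemidef)
    (hσ : σ.PosSemidef) : (hybrid S ρ σ).PosSemidef :=
  ((spreadTrace_posSemidef S hρ).hadamard (spreadTrace_posSemidef Sᶜ hσ)).smul
    (by positivity : (0 : ℂ) ≤ (2 ^ k : ℂ)⁻¹)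

lemma spreadTrace_empty (X : Op k) (a b : Fin k → Fin 2) :
    spreadTrace ∅ X a b = 2 ^ k * X a b := by
  simp [spreadTrace]

lemma hybrid_empty {ρ σ : Op k} (hσ : σ.trace = 1) : hybrid ∅ ρ σ = ρ := by
  ext a b
  simp [hybrid, spreadTrace_empty, spreadTrace_univ, hσ]

lemma hybrid_univ {ρ σ : Op k} (hρ : ρ.trace = 1) : hybrid Finset.univ ρ σ = σ := by
  ext a b
  simp [hybrid, spreadTrace_empty, spreadTrace_univ, hρ]

/-- The two hybrids differ only in which state supplies qubit `i`, so they agree once it is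
discarded. -/
lemma siteMix_hybrid_insert {S : Finset (Fin k)} {i : Fin k} (hi : i ∉ S) (ρ σ : Op k) :
    siteMix i (hybrid (insert i S) ρ σ) = siteMix i (hybrid S ρ σ) := by
  have hc : insert i (insert i S)ᶜ = Sᶜ := by
    rw [Finset.compl_insert, Finset.insert_erase (by simpa using hi)]
  ext a b
  simp only [siteMix_apply, hybrid, Matrix.of_apply, ← Finset.mul_sum,
    spreadTrace_update_of_mem (Finset.mem_insert_self i S),
    spreadTrace_update_of_mem (Finset.mem_compl.mpr hi), ← Finset.sum_mul,
    sum_spreadTrace_update_of_notMem hi,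
    sum_spreadTrace_update_of_notMem (S := (insert i S)ᶜ) (i := i) (by simp), hc]
  split_ifs
  · ring
  · rfl

lemma IsState.localCost_sub {ρ σ : Op k} (hρ : IsState ρ) (hσ : IsState σ) :
    LocalCost (ρ - σ) (2 * k) := by
  have key (S : Finset (Fin k)) :
      LocalCost (ρ - hybrid S ρ σ) (2 * S.card) ∧ (hybrid S ρ σ).trace = 1 := by
    induction S using Finset.induction_on with
    | empty =>
      rw [hybrid_empty hσ.trace_eq_one, sub_self]
      exact ⟨by simpa using LocalCost.zero, hρ.trace_eq_one⟩
    | insert i S hi ih =>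
      have hM := siteMix_hybrid_insert hi ρ σ
      have htr : (hybrid (insert i S) ρ σ).trace = 1 := by
        rw [← (siteMix_isPTP i).trace_map, hM, (siteMix_isPTP i).trace_map, ih.2]
      have h1 := hybrid_posSemidef S hρ.posSemidef hσ.posSemidef
      have h2 := hybrid_posSemidef (insert i S) hρ.posSemidef hσ.posSemidef
      -- Consecutive hybrids are states that differ by a single piece, of trace norm at most 2.
      have h3 := LocalCost.single i (hybrid S ρ σ - hybrid (insert i S) ρ σ)
        (h1.isHermitian.sub h2.isHermitian) (by rw [map_sub, hM, sub_self])
      have h4 := traceNorm_sub_le h1 h2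
      rw [ih.2, htr] at h4
      have h5 := ih.1.add _ _ _ _ h3
      rw [sub_add_sub_cancel] at h5
      refine ⟨h5.mono _ _ _ ?_, htr⟩
      rw [Finset.card_insert_of_notMem hi]
      push_cast
      norm_num at h4
      linarith
  have h := (key Finset.univ).1
  rwa [hybrid_univ hρ.trace_eq_one, Finset.card_univ, Fintype.card_fin] at h

end Hybrid

/-! ### Iterating over layers, and logarithmic depth. -/

section Circuit

variable {k : ℕ}

lemma LocalCost.map_noisyCircuit {L : ℕ} {p : ℝ} (hp0 : 0 ≤ p) (hp1 : p ≤ 1) {X : Op k} {w : ℝ}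
    (hX : LocalCost X w) (n : ℕ) (C : Fin n → Channel k)
    (hC : ∀ j, lightCone (C j).toLinearMap ≤ L) :
    LocalCost (noisyCircuit p n C X) ((2 * L * (1 - p)) ^ n * w) := by
  induction n with
  | zero => simpa [noisyCircuit] using hX
  | succ n ih =>
    have h := ((ih (fun j => C j.castSucc) fun j => hC _).map_channel (C (Fin.last n))
      (hC _)).map_depolarizing hp0 hp1
    rw [pow_succ]
    exact h.mono _ _ _ (le_of_eq (by ring))

lemma traceNorm_noisyCircuit_sub_le {L : ℕ} {p : ℝ} (hp0 : 0 ≤ p) (hp1 : p ≤ 1) (n : ℕ)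
    (C : Fin n → Channel k) (hC : ∀ j, lightCone (C j).toLinearMap ≤ L) {ρ σ : Op k}
    (hρ : IsState ρ) (hσ : IsState σ) :
    traceNorm (noisyCircuit p n C ρ - noisyCircuit p n C σ) ≤
      2 * k * (2 * L * (1 - p)) ^ n := by
  rw [← map_sub, mul_comm]
  exact ((hρ.localCost_sub hσ).map_noisyCircuit hp0 hp1 n C hC).traceNorm_le

end Circuit

lemma exists_depth_constant {r : ℝ} (h0 : 0 ≤ r) (h1 : r < 1) :
    ∃ c : ℝ, 0 < c ∧ ∀ (k n : ℕ) (ε : ℝ), 0 < ε → c * Real.log (k / ε) ≤ n → k * r ^ n ≤ ε := by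
  -- `r` may be `0`, where `Real.log` takes the default value `0`; a rate `s` strictly between `r`
  -- and `1` has a negative logarithm.
  obtain ⟨s, hrs, hs1⟩ := exists_between h1
  have hs0 : 0 < s := h0.trans_lt hrs
  have hlog : 0 < -Real.log s := neg_pos.mpr (Real.log_neg hs0 hs1)
  refine ⟨(-Real.log s)⁻¹, inv_pos.mpr hlog, fun k n ε hε hn => ?_⟩
  rcases k.eq_zero_or_pos with rfl | hk
  · simpa using hε.le
  have hk' : (0 : ℝ) < k := by exact_mod_cast hk
  rw [inv_mul_le_iff₀ hlog, Real.log_div hk'.ne' hε.ne'] at hn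
  have h2 : (k : ℝ) * s ^ n ≤ ε := by
    rw [← Real.log_le_log_iff (by positivity) hε, Real.log_mul hk'.ne' (by positivity),
      Real.log_pow]
    linarith
  exact (mul_le_mul_of_nonneg_left (pow_le_pow_left₀ h0 hrs.le n) hk'.le).trans h2

end NoisyCircuit

end

theorem mainTheorem9 (L : ℕ) (p : ℝ) (hp0 : 0 ≤ p) (hp1 : p ≤ 1) :
    (∀ (k n : ℕ) (C : Fin n → NoisyCircuit.Channel k),
      (∀ j, NoisyCircuit.lightCone (C j).toLinearMap ≤ L) →
      ∀ ρ σ : NoisyCircuit.Op k, NoisyCircuit.IsState ρ → NoisyCircuit.IsState σ →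
        NoisyCircuit.traceNorm
            (NoisyCircuit.noisyCircuit p n C ρ - NoisyCircuit.noisyCircuit p n C σ) ≤
          2 * (k : ℝ) * (2 * (L : ℝ) * (1 - p)) ^ n) ∧
    (2 * (L : ℝ) * (1 - p) < 1 →
      ∃ c : ℝ, 0 < c ∧
        ∀ (k n : ℕ) (C : Fin n → NoisyCircuit.Channel k),
          (∀ j, NoisyCircuit.lightCone (C j).toLinearMap ≤ L) →
          ∀ ε : ℝ, 0 < ε → c * Real.log ((k : ℝ) / ε) ≤ (n : ℝ) →
          ∀ ρ σ : NoisyCircuit.Op k, NoisyCircuit.IsState ρ → NoisyCircuit.IsState σ →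
            (1 / 2 : ℝ) * NoisyCircuit.traceNorm
              (NoisyCircuit.noisyCircuit p n C ρ - NoisyCircuit.noisyCircuit p n C σ) ≤ ε) := by
  refine ⟨fun k n C hC ρ σ hρ hσ =>
    NoisyCircuit.traceNorm_noisyCircuit_sub_le hp0 hp1 n C hC hρ hσ, fun hr => ?_⟩
  have h0 : 0 ≤ 2 * (L : ℝ) * (1 - p) := mul_nonneg (by positivity) (sub_nonneg.mpr hp1)
  obtain ⟨c, hc, h⟩ := NoisyCircuit.exists_depth_constant h0 hr
  refine ⟨c, hc, fun k n C hC ε hε hn ρ σ hρ hσ => ?_⟩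
  have h1 := h k n ε hε hn
  have h2 := NoisyCircuit.traceNorm_noisyCircuit_sub_le hp0 hp1 n C hC hρ hσ
  linarith
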